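/- Let $0<k<1$, $0<\beta<1$, $\alpha>0$ be the TCP Compound parameters, and let $p\in(0,1)$. Consider one TCP Compound connection with constant round trip time and no queuing, whose packets are lost independently of each other with probability $p$, with no upper bound on the window size. Its window size $W_n(p)$ at the end of the $n$-th round trip is the Markov chain on $\{1,2,3,\dots\}$ that moves from $w$ $$\text{to } \lfloor w+1+(\alpha w^{k}-1)^{+}\rfloor \text{ with probability } (1-p)^{w} \quad\text{(no loss)},$$ $$\text{to } \max\{1,\lfloor (1-\beta)w\rfloor\} \text{ with probability } 1-(1-p)^{w} \quad\text{(loss)},$$ where $x^+=\max\{x,0\}$. Then the chain $\{W_n(p)\}$ has a single communicating class that is aperiodic and positive recurrent, and all states outside this class are transient. Moreover, it has a unique stationary distribution $\pi$, and $E_\pi[W^\eta]=\sum_{w\ge 1}\pi(w)\,w^\eta<\infty$ for every real $\eta\ge 1$. -/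

import Mathlib

open scoped ENNReal NNReal

/-! ### Time-homogeneous Markov chains on a discrete state space

A chain on `S` is given by its transition law `P : S → PMF S`; `P x y` is the probability of
moving from `x` to `y` in one step. -/

namespace DiscreteChain

/-- The law of the chain after `n` steps, started at `x`. -/
noncomputable def law {S : Type*} (P : S → PMF S) (x : S) : ℕ → PMF S
  | 0 => PMF.pure x
  | n + 1 => (law P x n).bind P

/-- `y` is accessible from `x`: it is reached with positive probability after some number
`n ≥ 0` of steps. -/
def Accessible {S : Type*} (P : S → PMF S) (x y : S) : Prop :=
  ∃ n : ℕ, 0 < law P x n y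

/-- `x` and `y` communicate: each is accessible from the other. -/
def Communicates {S : Type*} (P : S → PMF S) (x y : S) : Prop :=
  Accessible P x y ∧ Accessible P y x

/-- Communicating classes are the equivalence classes of the relation `Communicates`. -/
def IsCommunicatingClass {S : Type*} (P : S → PMF S) (C : Set S) : Prop :=
  ∃ x : S, C = {y | Communicates P x y}

/-- `x` is aperiodic: the set of `n ≥ 1` such that the chain started at `x` is at `x` at time `n`
with positive probability has greatest common divisor `1`. (If that set is empty then every
`d` is a common divisor, and `x` is not aperiodic.) -/
def IsAperiodic {S : Type*} (P : S → PMF S) (x : S) : Prop :=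
  ∀ d : ℕ, (∀ n : ℕ, 1 ≤ n → 0 < law P x n x → d ∣ n) → d = 1

open Classical in
/-- `firstHit P y n x` is the probability that the chain started at `x` visits `y` for the first
time at time `n`, among the times `1, 2, 3, …` (time `0` does not count), by first-step analysis. -/
noncomputable def firstHit {S : Type*} (P : S → PMF S) (y : S) : ℕ → S → ℝ≥0∞
  | 0, _ => 0
  | 1, x => P x y
  | n + 2, x => ∑' z : S, if z = y then 0 else P x z * firstHit P y (n + 1) z

/-- The probability that the chain started at `x` ever returns to `x`. -/
noncomputable def returnProb {S : Type*} (P : S → PMF S) (x : S) : ℝ≥0∞ :=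
  ∑' n : ℕ, firstHit P x n x

/-- `x` is transient: the return to `x` is not certain. -/
def IsTransient {S : Type*} (P : S → PMF S) (x : S) : Prop :=
  returnProb P x < 1

/-- `x` is positive recurrent: the return to `x` is certain, and the expected return time is
finite. -/
def IsPositiveRecurrent {S : Type*} (P : S → PMF S) (x : S) : Prop :=
  returnProb P x = 1 ∧ ∑' n : ℕ, (n : ℝ≥0∞) * firstHit P x n x < ∞

/-- `π` is a stationary distribution: if the state has law `π`, so has the next state. -/
def IsStationary {S : Type*} (P : S → PMF S) (π : PMF S) : Prop :=
  π.bind P = π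

end DiscreteChain

/-! ### The TCP Compound window -/

namespace TCPCompound

/-- Window sizes are whole numbers of packets, at least one: the integer part, bounded below
by `1`. -/
noncomputable def toWindow (x : ℝ) : ℕ+ := ⟨max 1 ⌊x⌋₊, by positivity⟩

/-- The next window if no packet of the current window `w` is lost (and there is no queuing):
the loss-based component grows by `1`, the delay-based component by `(α w ^ k - 1)⁺`. -/
noncomputable def increase (α k : ℝ) (w : ℕ+) : ℕ+ :=
  toWindow ((w : ℝ) + 1 + max (α * (w : ℝ) ^ k - 1) 0)

/-- The next window if a loss is detected: both components, and so their sum, shrink by the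
factor `1 - β`. -/
noncomputable def decrease (β : ℝ) (w : ℕ+) : ℕ+ :=
  toWindow ((1 - β) * (w : ℝ))

/-- Whether the round trip with window `w` is free of loss. Each of the `w` packets is lost with
probability `p`, independently of the others, so there is no loss with probability
`(1 - p) ^ w`. -/
noncomputable def noLoss (p : ℝ≥0) (w : ℕ+) : PMF Bool :=
  PMF.ofFintype
    (fun b => if b then (((1 - p) ^ (w : ℕ) : ℝ≥0) : ℝ≥0∞)
      else ((1 - (1 - p) ^ (w : ℕ) : ℝ≥0) : ℝ≥0∞))
    (by
      have h : (1 - p) ^ (w : ℕ) ≤ 1 := pow_le_one₀ zero_le tsub_le_self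
      rw [Fintype.sum_bool]
      simp only [if_true, Bool.false_eq_true, if_false]
      exact_mod_cast add_tsub_cancel_of_le h)

/-- The transition law of the window size per round trip. -/
noncomputable def windowChain (α β k : ℝ) (p : ℝ≥0) (w : ℕ+) : PMF ℕ+ :=
  (noLoss p w).map (fun b : Bool => if b then increase α k w else decrease β w)

end TCPCompound

/-! Successive losses lead from any window down to 1, and a loss at 1 stays at 1. So 1 is accessible
from everywhere and has a loop: its class is aperiodic, a state outside it can fall into 1 with no
way back and is transient, and at most one stationary law exists (`IsStationary.unique`).

Existence and moments come from a Foster–Lyapunov function off the state 1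
(`exists_isStationary_of_drift`, `exists_lyapunov`). For large `w` a loss is almost certain, so `w ^
η` contracts in mean; finitely many small windows are repaired by a multiple of the bounded function
`1 - r ^ w`. The stationary law charges 1, hence its whole class, and charged states are positive
recurrent (`IsStationary.isPositiveRecurrent`). -/

theorem ENNReal.eq_of_le_of_tsum_eq {S : Type*} {f g : S → ℝ≥0∞} (hfg : ∀ x, f x ≤ g x)
    (hsum : ∑' x, f x = ∑' x, g x) (hfin : ∑' x, f x ≠ ∞) (x : S) : f x = g x := by
  by_contra hne
  exact (ENNReal.tsum_lt_tsum hfin hfg (lt_of_le_of_ne (hfg x) hne)).ne hsum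

/-! ### Accessibility and periods -/

namespace DiscreteChain

variable {S : Type*} (P : S → PMF S)

theorem law_succ_pos_iff (x y : S) (n : ℕ) :
    0 < law P x (n + 1) y ↔ ∃ z, 0 < law P x n z ∧ 0 < P z y := by
  simp [law, pos_iff_ne_zero]

theorem law_add (x : S) (m n : ℕ) :
    law P x (m + n) = (law P x m).bind fun z => law P z n := by
  induction n with
  | zero => simp [law]
  | succ n ih => rw [← add_assoc, law, ih, PMF.bind_bind]; rfl

theorem law_add_pos {x y z : S} {m n : ℕ} (h₁ : 0 < law P x m y) (h₂ : 0 < law P y n z) :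
    0 < law P x (m + n) z := by
  rw [law_add, pos_iff_ne_zero, ← PMF.mem_support_iff, PMF.mem_support_bind_iff]
  exact ⟨y, h₁.ne', h₂.ne'⟩

theorem law_one (x : S) : law P x 1 = P x := by simp [law]

variable {P}

theorem Accessible.refl (x : S) : Accessible P x x := ⟨0, by simp [law]⟩

theorem Accessible.trans {x y z : S} (h₁ : Accessible P x y) (h₂ : Accessible P y z) :
    Accessible P x z := by
  obtain ⟨m, hm⟩ := h₁
  obtain ⟨n, hn⟩ := h₂
  exact ⟨m + n, law_add_pos P hm hn⟩

theorem Accessible.single {x y : S} (h : 0 < P x y) : Accessible P x y :=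
  ⟨1, by rwa [law_one]⟩

/-- A set of states that is closed under one step is closed under accessibility. -/
theorem Accessible.mem_of_closed {s : S → Prop} (hs : ∀ x y, s x → 0 < P x y → s y) {x y : S}
    (hx : s x) (h : Accessible P x y) : s y := by
  obtain ⟨n, hn⟩ := h
  induction n generalizing y with
  | zero =>
    have : y = x := by
      by_contra hne
      simp [law, hne] at hn
    rwa [this]
  | succ n ih =>
    obtain ⟨z, hz, hzy⟩ := (law_succ_pos_iff P x y n).1 hn
    exact hs z y (ih hz) hzy

/-- Taking the loop at `a` once or twice gives two consecutive return times to `x`. -/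
theorem isAperiodic_of_self_loop {x a : S} (hxa : Accessible P x a) (hax : Accessible P a x)
    (ha : 0 < P a a) : IsAperiodic P x := by
  intro d hd
  obtain ⟨m, hm⟩ := hxa
  obtain ⟨n, hn⟩ := hax
  rw [← law_one P] at ha
  have h₁ := law_add_pos P (law_add_pos P hm ha) hn
  have h₂ := law_add_pos P (law_add_pos P (law_add_pos P hm ha) ha) hn
  have d₁ := hd _ (by omega) h₁
  have d₂ := hd _ (by omega) h₂
  have : m + 1 + 1 + n = (m + 1 + n) + 1 := by ring
  rw [this] at d₂
  exact Nat.dvd_one.1 ((Nat.dvd_add_right d₁).1 d₂)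

/-! ### Invariant measures and uniqueness of the stationary law -/

variable (P)

/-- The image of the measure with masses `m` under one step of the chain. -/
noncomputable def push (m : S → ℝ≥0∞) (y : S) : ℝ≥0∞ := ∑' x, m x * P x y

theorem tsum_push_mul (m V : S → ℝ≥0∞) :
    ∑' y, push P m y * V y = ∑' x, m x * ∑' y, P x y * V y := by
  simp only [push, ← ENNReal.tsum_mul_right, ← ENNReal.tsum_mul_left]
  rw [ENNReal.tsum_comm]
  simp only [mul_assoc]

theorem tsum_push (m : S → ℝ≥0∞) : ∑' y, push P m y = ∑' x, m x := by
  simpa [PMF.tsum_coe] using tsum_push_mul P m (fun _ => 1)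

theorem push_mono {m m' : S → ℝ≥0∞} (h : ∀ x, m x ≤ m' x) (y : S) : push P m y ≤ push P m' y :=
  ENNReal.tsum_le_tsum fun x => mul_le_mul_left (h x) _

theorem isStationary_iff_push (π : PMF S) : IsStationary P π ↔ push P π = π := by
  constructor
  · intro h
    funext y
    conv_rhs => rw [← h]
    rfl
  · intro h
    ext y
    exact congrFun h y

variable {P}

theorem pos_of_accessible {m : S → ℝ≥0∞} (hm : push P m = m) {x y : S} (hx : 0 < m x)
    (h : Accessible P x y) : 0 < m y := by
  refine Accessible.mem_of_closed (s := fun z => 0 < m z) (fun x y hx hxy => ?_) hx h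
  rw [← hm]
  exact (ENNReal.mul_pos hx.ne' hxy.ne').trans_le (ENNReal.le_tsum x)

/-- If some state is accessible from every state, then it is charged by every stationary law. -/
theorem IsStationary.pos_of_forall_accessible {π : PMF S} (hπ : IsStationary P π) {a : S}
    (ha : ∀ x, Accessible P x a) : 0 < π a := by
  obtain ⟨x, hx⟩ := π.support_nonempty
  exact pos_of_accessible ((isStationary_iff_push P π).1 hπ)
    (pos_iff_ne_zero.2 ((PMF.mem_support_iff _ _).1 hx)) (ha x)

/-- The minimum `m` of two invariant laws is pushed below itself with its mass kept, so it is
invariant, and so is `π - m`. The latter vanishes at `a`, hence at every state leading to `a`, so `π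
≤ π'`; equal masses finish. -/
theorem IsStationary.eq_of_le_apply {a : S} (ha : ∀ x, Accessible P x a) {π π' : PMF S}
    (hπ : IsStationary P π) (hπ' : IsStationary P π') (hle : π a ≤ π' a) : π = π' := by
  rw [isStationary_iff_push] at hπ hπ'
  set m : S → ℝ≥0∞ := fun x => min (π x) (π' x) with hm_def
  have hmπ : ∀ x, m x ≤ π x := fun x => min_le_left _ _
  have hmπ' : ∀ x, m x ≤ π' x := fun x => min_le_right _ _
  have hm_fin : ∑' x, m x ≠ ∞ :=
    ne_top_of_le_ne_top (by rw [π.tsum_coe]; exact ENNReal.one_ne_top)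
      (ENNReal.tsum_le_tsum hmπ)
  have hm : push P m = m := by
    funext x
    refine ENNReal.eq_of_le_of_tsum_eq (fun y => le_min ?_ ?_) (tsum_push P m)
      (by rwa [tsum_push]) x
    · exact (push_mono P hmπ y).trans_eq (congrFun hπ y)
    · exact (push_mono P hmπ' y).trans_eq (congrFun hπ' y)
  set d : S → ℝ≥0∞ := fun x => π x - m x with hd_def
  have hdm : ∀ x, d x + m x = π x := fun x => tsub_add_cancel_of_le (hmπ x)
  have hd : push P d = d := by
    funext y
    have h : push P d y + push P m y = d y + m y := by
      rw [hdm y, ← congrFun hπ y]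
      simp only [push, ← ENNReal.tsum_add, ← add_mul, hdm]
    rw [hm] at h
    exact (ENNReal.add_left_inj (ENNReal.ne_top_of_tsum_ne_top hm_fin y)).1 h
  have hd0 : ∀ x, d x = 0 := by
    intro x
    by_contra hx
    have h := pos_of_accessible hd (pos_iff_ne_zero.2 hx) (ha x)
    simp [hd_def, hm_def, hle] at h
  ext x
  refine ENNReal.eq_of_le_of_tsum_eq (f := π) (g := π') (fun y => ?_)
    (by rw [π.tsum_coe, π'.tsum_coe]) (by rw [π.tsum_coe]; exact ENNReal.one_ne_top) x
  rw [← hdm y, hd0, zero_add]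
  exact hmπ' y

/-- A chain with a state that is accessible from everywhere has at most one stationary law. -/
theorem IsStationary.unique {a : S} (ha : ∀ x, Accessible P x a) {π π' : PMF S}
    (hπ : IsStationary P π) (hπ' : IsStationary P π') : π = π' := by
  rcases le_total (π a) (π' a) with h | h
  · exact hπ.eq_of_le_apply ha hπ' h
  · exact (hπ'.eq_of_le_apply ha hπ h).symm

/-! ### Return times, recurrence and transience -/

variable (P)

open Classical in
/-- The probability that the chain started at `x` avoids `y` at the times `1, …, n`. -/
noncomputable def avoid (y : S) : ℕ → S → ℝ≥0∞
  | 0, _ => 1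
  | n + 1, x => ∑' z : S, P x z * if z = y then 0 else avoid y n z

open Classical in
theorem firstHit_succ_succ (y : S) (n : ℕ) (x : S) :
    firstHit P y (n + 2) x = ∑' z, P x z * if z = y then 0 else firstHit P y (n + 1) z := by
  rw [firstHit]
  exact tsum_congr fun z => by split_ifs <;> simp

theorem firstHit_add_avoid (y : S) (n : ℕ) (x : S) :
    firstHit P y (n + 1) x + avoid P y (n + 1) x = avoid P y n x := by
  classical
  induction n generalizing x with
  | zero =>
    have h : P x y = ∑' z, P x z * if z = y then 1 else 0 := by simp
    simp only [firstHit, avoid]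
    rw [h, ← ENNReal.tsum_add, ← (P x).tsum_coe]
    exact tsum_congr fun z => by split_ifs <;> simp
  | succ n ih =>
    rw [firstHit_succ_succ, avoid, avoid, ← ENNReal.tsum_add]
    refine tsum_congr fun z => ?_
    rw [← mul_add]
    split_ifs
    · simp
    · rw [ih]

theorem sum_firstHit_add_avoid (y : S) (n : ℕ) (x : S) :
    ∑ i ∈ Finset.range (n + 1), firstHit P y i x + avoid P y n x = 1 := by
  induction n with
  | zero => simp [firstHit, avoid]
  | succ n ih => rw [Finset.sum_range_succ, add_assoc, firstHit_add_avoid, ih]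

/-- Summation by parts: both sides are the mean of the hitting time truncated at `n`. -/
theorem sum_mul_firstHit_add_avoid (y : S) (n : ℕ) (x : S) :
    ∑ i ∈ Finset.range (n + 1), (i : ℝ≥0∞) * firstHit P y i x + n * avoid P y n x =
      ∑ i ∈ Finset.range n, avoid P y i x := by
  induction n with
  | zero => simp
  | succ n ih =>
    rw [Finset.sum_range_succ, add_assoc, ← mul_add, firstHit_add_avoid,
      Finset.sum_range_succ (fun i => avoid P y i x) n, ← ih]
    push_cast
    ring

theorem tsum_firstHit_le_one (y x : S) : ∑' n, firstHit P y n x ≤ 1 := by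
  refine ENNReal.tsum_le_of_sum_range_le fun n => ?_
  refine (Finset.sum_le_sum_of_subset (Finset.range_mono n.le_succ)).trans ?_
  rw [← sum_firstHit_add_avoid P y n x]
  exact le_self_add

open Classical in
theorem tsum_firstHit_eq (y x : S) :
    ∑' n, firstHit P y n x =
      ∑' z, P x z * if z = y then 1 else ∑' n, firstHit P y n z := by
  have h0 : ∀ w, ∑' n, firstHit P y n w = ∑' n, firstHit P y (n + 1) w := fun w => by
    rw [tsum_eq_zero_add' ENNReal.summable, firstHit, zero_add]
  rw [h0, tsum_eq_zero_add' ENNReal.summable]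
  simp only [zero_add, firstHit_succ_succ]
  rw [ENNReal.tsum_comm]
  have h : firstHit P y 1 x = ∑' z, P x z * if z = y then 1 else 0 := by simp [firstHit]
  rw [h, ← ENNReal.tsum_add]
  refine tsum_congr fun z => ?_
  rw [ENNReal.tsum_mul_left, ← mul_add, h0 z]
  split_ifs <;> simp

variable {P}

theorem isPositiveRecurrent_of_tsum_avoid {y : S} (h : ∑' n, avoid P y n y ≠ ∞) :
    IsPositiveRecurrent P y := by
  constructor
  · have h₀ : Filter.Tendsto (fun n => avoid P y n y) Filter.atTop (nhds 0) :=
      ENNReal.tendsto_atTop_zero_of_tsum_ne_top h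
    have h₁ : Filter.Tendsto
        (fun n => ∑ i ∈ Finset.range (n + 1), firstHit P y i y + avoid P y n y)
        Filter.atTop (nhds (returnProb P y + 0)) :=
      ((ENNReal.tendsto_nat_tsum _).comp (Filter.tendsto_add_atTop_nat 1)).add h₀
    simp only [sum_firstHit_add_avoid, add_zero] at h₁
    exact (tendsto_nhds_unique h₁ tendsto_const_nhds)
  · refine lt_of_le_of_lt (ENNReal.tsum_le_of_sum_range_le fun n => ?_) (lt_top_iff_ne_top.2 h)
    refine (Finset.sum_le_sum_of_subset (Finset.range_mono n.le_succ)).trans ?_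
    refine le_trans ?_ (ENNReal.sum_le_tsum (Finset.range n))
    rw [← sum_mul_firstHit_add_avoid]
    exact le_self_add

/-- Decomposition by the last visit to `y` among the times `1, …, n`; with `i` steps remaining after
it, it contributes `π y * avoid P y i y`. -/
theorem IsStationary.sum_avoid {π : PMF S} (hπ : IsStationary P π) (y : S) (n : ℕ) :
    π y * ∑ i ∈ Finset.range n, avoid P y i y + ∑' x, π x * avoid P y n x = 1 := by
  classical
  induction n with
  | zero => simp [avoid, π.tsum_coe]
  | succ n ih =>
    rw [← ih, Finset.sum_range_succ, mul_add, add_assoc]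
    congr 1
    have h : π y * avoid P y n y = ∑' x, π x * if x = y then avoid P y n x else 0 := by simp
    simp only [avoid]
    rw [← tsum_push_mul, (isStationary_iff_push P π).1 hπ, h, ← ENNReal.tsum_add]
    refine tsum_congr fun x => ?_
    split_ifs <;> simp

/-- A state charged by a stationary law is positive recurrent. -/
theorem IsStationary.isPositiveRecurrent {π : PMF S} (hπ : IsStationary P π) {y : S}
    (hy : 0 < π y) : IsPositiveRecurrent P y := by
  refine isPositiveRecurrent_of_tsum_avoid fun h => ?_
  have hle : π y * ∑' n, avoid P y n y ≤ 1 := by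
    rw [← ENNReal.tsum_mul_left]
    refine ENNReal.tsum_le_of_sum_range_le fun n => ?_
    rw [← Finset.mul_sum, ← hπ.sum_avoid y n]
    exact le_self_add
  rw [h, ENNReal.mul_top hy.ne'] at hle
  simp at hle

theorem firstHit_eq_zero_of_not_accessible {x y : S} (h : ¬ Accessible P x y) (n : ℕ) :
    firstHit P y n x = 0 := by
  classical
  induction n generalizing x with
  | zero => rfl
  | succ n ih =>
    cases n with
    | zero =>
      by_contra hne
      exact h (Accessible.single (pos_iff_ne_zero.2 hne))
    | succ n =>
      rw [firstHit_succ_succ, ENNReal.tsum_eq_zero]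
      intro z
      by_cases hz : P x z = 0
      · simp [hz]
      · rw [ih fun hzy => h ((Accessible.single (pos_iff_ne_zero.2 hz)).trans hzy)]
        simp

/-- A state from which the chain may go to a state without way back is transient. -/
theorem isTransient_of_accessible {x a : S} (hxa : Accessible P x a) (hax : ¬ Accessible P a x) :
    IsTransient P x := by
  classical
  refine lt_of_le_of_ne (tsum_firstHit_le_one P x x) fun h => ?_
  -- States that hit `x` surely form a closed set: an average of numbers at most 1 equals 1 only if
  -- each charged one is 1.
  have hclosed : ∀ w z, ∑' n, firstHit P x n w = 1 → 0 < P w z →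
      ∑' n, firstHit P x n z = 1 := by
    intro w z hw hwz
    by_cases hzx : z = x
    · rw [hzx]
      exact h
    have heq := ENNReal.eq_of_le_of_tsum_eq
      (f := fun z => P w z * if z = x then 1 else ∑' n, firstHit P x n z) (g := P w)
      (fun z => mul_le_of_le_one_right' (by
        split_ifs
        · exact le_rfl
        · exact tsum_firstHit_le_one P x z))
      (by rw [← tsum_firstHit_eq, hw, (P w).tsum_coe])
      (by rw [← tsum_firstHit_eq, hw]; exact ENNReal.one_ne_top) z
    simp only [hzx, if_false] at heq
    refine (ENNReal.mul_right_inj hwz.ne' ((P w).apply_ne_top z)).1 ?_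
    rw [heq, mul_one]
  have ha : ∑' n, firstHit P x n a = 1 :=
    Accessible.mem_of_closed (s := fun w => ∑' n, firstHit P x n w = 1) hclosed h hxa
  simp [firstHit_eq_zero_of_not_accessible hax] at ha

/-! ### Excursions and the Foster–Lyapunov criterion -/

variable (P)

open Classical in
/-- The law at time `n` of the chain started at `a` and killed on its return to `a`. -/
noncomputable def excursion (a : S) : ℕ → S → ℝ≥0∞
  | 0, x => if x = a then 1 else 0
  | n + 1, x => if x = a then 0 else push P (excursion a n) x

variable {P}

theorem tsum_excursion_succ_mul_le (a : S) (n : ℕ) (V : S → ℝ≥0∞) :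
    ∑' x, excursion P a (n + 1) x * V x ≤
      ∑' x, excursion P a n x * ∑' y, P x y * V y := by
  rw [← tsum_push_mul]
  refine ENNReal.tsum_le_tsum fun x => mul_le_mul_left ?_ _
  simp only [excursion]
  split_ifs
  · exact zero_le
  · exact le_rfl

theorem tsum_excursion_zero_mul (a : S) (V : S → ℝ≥0∞) :
    ∑' x, excursion P a 0 x * V x = V a := by
  simp [excursion]

/-- The drift inequality telescopes along the excursion. Killing at `a` removes the only state where
it may fail. -/
theorem sum_excursion_mul_le {a : S} {V f : S → ℝ≥0∞}
    (hV : ∀ x, x ≠ a → ∑' y, P x y * V y + f x ≤ V x) (n : ℕ) :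
    ∑ i ∈ Finset.range n, ∑' x, excursion P a (i + 1) x * f x +
      ∑' x, excursion P a (n + 1) x * V x ≤ ∑' y, P a y * V y := by
  induction n with
  | zero =>
    simpa [tsum_excursion_zero_mul] using tsum_excursion_succ_mul_le a 0 V (P := P)
  | succ n ih =>
    refine le_trans ?_ ih
    rw [Finset.sum_range_succ, add_assoc]
    gcongr
    refine (add_le_add_right (tsum_excursion_succ_mul_le a (n + 1) V) _).trans ?_
    rw [← ENNReal.tsum_add]
    refine ENNReal.tsum_le_tsum fun x => ?_
    rw [← mul_add]
    by_cases hx : x = a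
    · simp [excursion, hx]
    · rw [add_comm (f x)]
      exact mul_le_mul_right (hV x hx) _

theorem tsum_tsum_excursion_mul_le {a : S} {V f : S → ℝ≥0∞}
    (hV : ∀ x, x ≠ a → ∑' y, P x y * V y + f x ≤ V x) :
    ∑' x, (∑' n, excursion P a n x) * f x ≤ f a + ∑' y, P a y * V y := by
  simp only [← ENNReal.tsum_mul_right]
  rw [ENNReal.tsum_comm, tsum_eq_zero_add' ENNReal.summable, tsum_excursion_zero_mul]
  gcongr
  exact ENNReal.tsum_le_of_sum_range_le fun n => le_self_add.trans (sum_excursion_mul_le hV n)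

/-- One step conserves total mass, so balance at all states but one forces it at the last.
Recurrence of `a` thus need not be known beforehand. -/
theorem push_eq_self_of_forall_ne {m : S → ℝ≥0∞} (h : ∑' x, m x ≠ ∞) {a : S}
    (hne : ∀ x, x ≠ a → push P m x = m x) : push P m = m := by
  classical
  have hrest : ∀ y, (if y = a then 0 else push P m y) = if y = a then 0 else m y := by
    intro y
    split_ifs with hy
    · rfl
    · exact hne y hy
  have hrest_fin : ∑' y, (if y = a then 0 else m y) ≠ ∞ :=
    ne_top_of_le_ne_top h (ENNReal.tsum_le_tsum fun y => by
      split_ifs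
      · exact zero_le
      · exact le_rfl)
  have hs := tsum_push P m
  rw [ENNReal.tsum_eq_add_tsum_ite (f := push P m) a,
    ENNReal.tsum_eq_add_tsum_ite (f := m) a, tsum_congr hrest] at hs
  funext x
  by_cases hx : x = a
  · rw [hx]
    exact (ENNReal.add_left_inj hrest_fin).1 hs
  · exact hne x hx

theorem push_tsum_excursion {a : S} (h : ∑' x, ∑' n, excursion P a n x ≠ ∞) :
    push P (fun x => ∑' n, excursion P a n x) = fun x => ∑' n, excursion P a n x := by
  refine push_eq_self_of_forall_ne h (a := a) fun x hx => ?_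
  have h₁ : push P (fun x => ∑' n, excursion P a n x) x =
      ∑' n, push P (excursion P a n) x := by
    simp only [push, ← ENNReal.tsum_mul_right]
    exact ENNReal.tsum_comm
  have h₂ : ∑' n, excursion P a n x = ∑' n, excursion P a (n + 1) x := by
    rw [tsum_eq_zero_add' ENNReal.summable]
    simp [excursion, hx]
  rw [h₁, h₂]
  exact tsum_congr fun n => by simp [excursion, hx]

/-- **Foster–Lyapunov criterion**: a drift condition outside one state gives a stationary law with
a bounded moment. -/
theorem exists_isStationary_of_drift {a : S} {V f : S → ℝ≥0∞} (hf : ∀ x, 1 ≤ f x)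
    (hV : ∀ x, x ≠ a → ∑' y, P x y * V y + f x ≤ V x)
    (hfa : f a ≠ ∞) (hVa : ∑' y, P a y * V y ≠ ∞) :
    ∃ π : PMF S, IsStationary P π ∧ ∑' x, π x * f x < ∞ := by
  set μ : S → ℝ≥0∞ := fun x => ∑' n, excursion P a n x with hμ
  have hμf : ∑' x, μ x * f x ≠ ∞ :=
    ne_top_of_le_ne_top (ENNReal.add_ne_top.2 ⟨hfa, hVa⟩) (tsum_tsum_excursion_mul_le hV)
  have hfin : ∑' x, μ x ≠ ∞ :=
    ne_top_of_le_ne_top hμf (ENNReal.tsum_le_tsum fun x => le_mul_of_one_le_right' (hf x))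
  have hpos : ∑' x, μ x ≠ 0 := by
    intro h0
    have h₁ := ENNReal.tsum_eq_zero.1 (ENNReal.tsum_eq_zero.1 h0 a) 0
    simp [excursion] at h₁
  refine ⟨PMF.normalize μ hpos hfin, ?_, ?_⟩
  · rw [isStationary_iff_push]
    funext y
    simp only [push, PMF.normalize_apply]
    have : ∀ x, μ x * (∑' x, μ x)⁻¹ * P x y = μ x * P x y * (∑' x, μ x)⁻¹ := fun x => by ring
    simp only [this, ENNReal.tsum_mul_right]
    congr 1
    exact congrFun (push_tsum_excursion hfin) y
  · have : ∀ x, PMF.normalize μ hpos hfin x * f x = μ x * f x * (∑' x, μ x)⁻¹ := fun x => by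
      rw [PMF.normalize_apply]
      ring
    simp only [this, ENNReal.tsum_mul_right]
    exact ENNReal.mul_lt_top (lt_top_iff_ne_top.2 hμf) (ENNReal.inv_lt_top.2
      (pos_iff_ne_zero.2 hpos))

end DiscreteChain

/-! ### Drift of the TCP Compound window -/

namespace TCPCompound

open DiscreteChain Filter

theorem toWindow_coe (x : ℝ) : ((toWindow x : ℕ+) : ℕ) = max 1 ⌊x⌋₊ := rfl

theorem toWindow_le {x : ℝ} (hx : 1 ≤ x) : ((toWindow x : ℕ) : ℝ) ≤ x := by
  rw [toWindow_coe, Nat.cast_max, Nat.cast_one]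
  exact max_le hx (Nat.floor_le (by linarith))

theorem one_le_cast (w : ℕ+) : (1 : ℝ) ≤ (w : ℕ) := Nat.one_le_cast.2 w.pos

section

variable {α β k : ℝ}

theorem increase_le (hα : 0 < α) (hk₁ : k < 1) (w : ℕ+) :
    ((increase α k w : ℕ) : ℝ) ≤ (2 + α) * (w : ℕ) := by
  have hw := one_le_cast w
  have hwk : ((w : ℕ) : ℝ) ^ k ≤ (w : ℕ) := Real.rpow_le_self_of_one_le hw hk₁.le
  have h₀ : (0 : ℝ) ≤ max (α * ((w : ℕ) : ℝ) ^ k - 1) 0 := le_max_right _ _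
  have h₁ : max (α * ((w : ℕ) : ℝ) ^ k - 1) 0 ≤ α * (w : ℕ) :=
    max_le (by nlinarith) (by positivity)
  refine (toWindow_le (by linarith)).trans ?_
  linarith

theorem decrease_lt (hβ₀ : 0 < β) (hβ₁ : β < 1) {w : ℕ+} (hw : w ≠ 1) : decrease β w < w := by
  have hw1 : 1 < (w : ℕ) := lt_of_le_of_ne w.pos fun h => hw (PNat.coe_eq_one_iff.1 h.symm)
  have hwpos := one_le_cast w
  rw [← PNat.coe_lt_coe, decrease, toWindow_coe]
  refine max_lt hw1 ((Nat.floor_lt ?_).2 ?_) <;> nlinarith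

theorem decrease_one (hβ₀ : 0 < β) : decrease β 1 = 1 := by
  rw [← PNat.coe_inj, decrease, toWindow_coe]
  have : ⌊(1 - β) * ((1 : ℕ+) : ℕ)⌋₊ ≤ 1 := Nat.floor_le_of_le (by simp; linarith)
  simpa using this

theorem tsum_windowChain_mul (α β k : ℝ) (p : ℝ≥0) (w : ℕ+) (V : ℕ+ → ℝ≥0∞) :
    ∑' z, windowChain α β k p w z * V z =
      (((1 - p) ^ (w : ℕ) : ℝ≥0) : ℝ≥0∞) * V (increase α k w) +
        ((1 - (1 - p) ^ (w : ℕ) : ℝ≥0) : ℝ≥0∞) * V (decrease β w) := by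
  have h : ∀ z, windowChain α β k p w z * V z =
      (((1 - p) ^ (w : ℕ) : ℝ≥0) : ℝ≥0∞) * (if z = increase α k w then V z else 0) +
        ((1 - (1 - p) ^ (w : ℕ) : ℝ≥0) : ℝ≥0∞) * (if z = decrease β w then V z else 0) := by
    intro z
    rw [windowChain, PMF.map_apply, tsum_bool]
    simp only [noLoss, PMF.ofFintype_apply, Bool.false_eq_true, if_true, if_false]
    split_ifs <;> ring
  simp only [h]
  rw [ENNReal.tsum_add, ENNReal.tsum_mul_left, ENNReal.tsum_mul_left, tsum_ite_eq, tsum_ite_eq]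

theorem windowChain_decrease_pos (α β k : ℝ) {p : ℝ≥0} (hp₀ : 0 < p) (w : ℕ+) :
    0 < windowChain α β k p w (decrease β w) := by
  have h := tsum_windowChain_mul α β k p w (fun z => if z = decrease β w then 1 else 0)
  simp only [mul_ite, mul_one, mul_zero, tsum_ite_eq, if_true] at h
  rw [h]
  refine lt_of_lt_of_le ?_ le_add_self
  rw [ENNReal.coe_pos, tsub_pos_iff_lt]
  exact pow_lt_one₀ zero_le (tsub_lt_self zero_lt_one hp₀) w.ne_zero

theorem accessible_one (α k : ℝ) (hβ₀ : 0 < β) (hβ₁ : β < 1) {p : ℝ≥0} (hp₀ : 0 < p)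
    (w : ℕ+) : Accessible (windowChain α β k p) w 1 := by
  induction w using PNat.strongInductionOn with
  | _ w ih =>
    by_cases hw : w = 1
    · rw [hw]
      exact Accessible.refl 1
    · exact (Accessible.single (windowChain_decrease_pos α β k hp₀ w)).trans
        (ih _ (decrease_lt hβ₀ hβ₁ hw))

theorem windowChain_one_one_pos (α k : ℝ) (hβ₀ : 0 < β) {p : ℝ≥0} (hp₀ : 0 < p) :
    0 < windowChain α β k p 1 1 := by
  have h := windowChain_decrease_pos α β k hp₀ 1
  rwa [decrease_one hβ₀] at h

/-- For large windows, the drift of `w ^ η` is negative and of order `w ^ η`. -/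
theorem eventually_rpow_drift {q η : ℝ} (hα : 0 < α) (hβ₀ : 0 < β) (hβ₁ : β < 1) (hk₁ : k < 1)
    (hq₀ : 0 < q) (hq₁ : q < 1) (hη : 1 ≤ η) :
    ∃ N : ℕ, ∀ w : ℕ+, N ≤ (w : ℕ) →
      q ^ (w : ℕ) * ((increase α k w : ℕ) : ℝ) ^ η +
        (1 - q ^ (w : ℕ)) * ((decrease β w : ℕ) : ℝ) ^ η + β / 2 * ((w : ℕ) : ℝ) ^ η ≤
      ((w : ℕ) : ℝ) ^ η := by
  have hη₀ : 0 ≤ η := by linarith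
  have ht : Tendsto (fun n : ℕ => q ^ n * (2 + α) ^ η) atTop (nhds 0) := by
    simpa using (tendsto_pow_atTop_nhds_zero_of_lt_one hq₀.le hq₁).mul_const ((2 + α) ^ η)
  obtain ⟨N₁, hN₁⟩ := eventually_atTop.1 (ht.eventually (ge_mem_nhds (half_pos hβ₀)))
  -- Beyond this bound `(1 - β) * w ≥ 1`, so the floor at 1 in `toWindow` does not spoil the
  -- contraction.
  obtain ⟨N₂, hN₂⟩ := exists_nat_ge (1 / (1 - β))
  refine ⟨max N₁ N₂, fun w hw => ?_⟩
  have hw₁ := hN₁ w (le_trans (le_max_left _ _) hw)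
  have hw₂ : 1 / (1 - β) ≤ (w : ℕ) :=
    hN₂.trans (Nat.cast_le.2 (le_trans (le_max_right _ _) hw))
  rw [div_le_iff₀ (by linarith)] at hw₂
  have hwη : (0 : ℝ) ≤ ((w : ℕ) : ℝ) ^ η := by positivity
  have hq : q ^ (w : ℕ) ≤ 1 := pow_le_one₀ hq₀.le hq₁.le
  have hqpos : 0 < q ^ (w : ℕ) := pow_pos hq₀ _
  have hinc : ((increase α k w : ℕ) : ℝ) ^ η ≤ (2 + α) ^ η * ((w : ℕ) : ℝ) ^ η := by
    rw [← Real.mul_rpow (by linarith) (by positivity)]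
    exact Real.rpow_le_rpow (by positivity) (increase_le hα hk₁ w) hη₀
  have hdec : ((decrease β w : ℕ) : ℝ) ^ η ≤ (1 - β) * ((w : ℕ) : ℝ) ^ η := by
    calc ((decrease β w : ℕ) : ℝ) ^ η ≤ ((1 - β) * (w : ℕ)) ^ η :=
          Real.rpow_le_rpow (by positivity) (toWindow_le (by linarith)) hη₀
      _ = (1 - β) ^ η * ((w : ℕ) : ℝ) ^ η := Real.mul_rpow (by linarith) (by positivity)
      _ ≤ _ := by
          gcongr
          exact Real.rpow_le_self_of_le_one (by linarith) (by linarith) hη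
  have h₁ : q ^ (w : ℕ) * ((increase α k w : ℕ) : ℝ) ^ η ≤ β / 2 * ((w : ℕ) : ℝ) ^ η := by
    calc _ ≤ q ^ (w : ℕ) * ((2 + α) ^ η * ((w : ℕ) : ℝ) ^ η) := by gcongr
      _ = q ^ (w : ℕ) * (2 + α) ^ η * ((w : ℕ) : ℝ) ^ η := by ring
      _ ≤ _ := by gcongr
  have h₂ : (1 - q ^ (w : ℕ)) * ((decrease β w : ℕ) : ℝ) ^ η ≤
      (1 - β) * ((w : ℕ) : ℝ) ^ η :=
    (mul_le_of_le_one_left (by positivity) (by linarith)).trans hdec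
  linarith

/-- The bounded function `1 - r ^ w` has negative drift at every window larger than one. -/
theorem one_sub_pow_drift {q r : ℝ} (hβ₀ : 0 < β) (hβ₁ : β < 1) (hq₀ : 0 < q) (hq₁ : q < 1)
    (hr : r = (1 - q) / 2) {w : ℕ+} (hw : w ≠ 1) :
    q ^ (w : ℕ) * (1 - r ^ (increase α k w : ℕ)) +
      (1 - q ^ (w : ℕ)) * (1 - r ^ (decrease β w : ℕ)) + r ^ (w : ℕ) ≤ 1 - r ^ (w : ℕ) := by
  have hr₀ : 0 < r := by linarith
  have hr₁ : r ≤ 1 := by linarith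
  have hqw : q ^ (w : ℕ) ≤ q := pow_le_of_le_one hq₀.le hq₁.le w.ne_zero
  have hdw : (decrease β w : ℕ) + 1 ≤ w := PNat.coe_lt_coe _ _ |>.2 (decrease_lt hβ₀ hβ₁ hw)
  -- A loss has probability at least `1 - q = 2 * r` and lowers the window by at least 1, which
  -- gains a factor `1 / r`; together they yield `2 * r ^ w`.
  have hdec : r ^ (w : ℕ) ≤ r ^ (decrease β w : ℕ) * r := by
    rw [← pow_succ]
    exact pow_le_pow_of_le_one hr₀.le hr₁ hdw
  have hinc : 0 ≤ q ^ (w : ℕ) * r ^ (increase α k w : ℕ) := by positivity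
  have h : (1 - q) * r ^ (decrease β w : ℕ) ≤ (1 - q ^ (w : ℕ)) * r ^ (decrease β w : ℕ) := by
    gcongr
  have hq : 1 - q = 2 * r := by linarith
  rw [hq] at h
  linarith

/-- The factor `2 / β` turns the drift `-β / 2 * w ^ η` of large windows into `-w ^ η`. Below `N`,
the drift `-A * r ^ w` of the bounded term dominates the finitely many defects `D w`. -/
theorem exists_lyapunov {q η : ℝ} (hα : 0 < α) (hβ₀ : 0 < β) (hβ₁ : β < 1) (hk₁ : k < 1)
    (hq₀ : 0 < q) (hq₁ : q < 1) (hη : 1 ≤ η) :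
    ∃ V : ℕ+ → ℝ, (∀ w, 0 ≤ V w) ∧ ∀ w : ℕ+, w ≠ 1 →
      q ^ (w : ℕ) * V (increase α k w) + (1 - q ^ (w : ℕ)) * V (decrease β w) +
        ((w : ℕ) : ℝ) ^ η ≤ V w := by
  obtain ⟨N, hN⟩ := eventually_rpow_drift hα hβ₀ hβ₁ hk₁ hq₀ hq₁ hη
  obtain ⟨r, hr⟩ : ∃ r, r = (1 - q) / 2 := ⟨_, rfl⟩
  have hr₀ : 0 < r := by linarith
  have hr₁ : r ≤ 1 := by linarith
  set D : ℕ+ → ℝ := fun w => 2 / β * (q ^ (w : ℕ) * ((increase α k w : ℕ) : ℝ) ^ η +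
    (1 - q ^ (w : ℕ)) * ((decrease β w : ℕ) : ℝ) ^ η) + ((w : ℕ) : ℝ) ^ η with hD
  have hq : ∀ w : ℕ+, q ^ (w : ℕ) ≤ 1 := fun w => pow_le_one₀ hq₀.le hq₁.le
  have hD₀ : ∀ w, 0 ≤ D w := fun w => by
    have : 0 ≤ 1 - q ^ (w : ℕ) := sub_nonneg.2 (hq w)
    positivity
  obtain ⟨A, hA₀, hA⟩ : ∃ A : ℝ, 0 ≤ A ∧ ∀ w : ℕ+, (w : ℕ) < N → D w ≤ A * r ^ (w : ℕ) := by
    have hfin : {w : ℕ+ | (w : ℕ) < N}.Finite :=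
      (Set.finite_lt_nat N).preimage PNat.coe_injective.injOn
    refine ⟨∑ w ∈ hfin.toFinset, D w / r ^ (w : ℕ),
      Finset.sum_nonneg fun w _ => div_nonneg (hD₀ w) (by positivity), fun w hw => ?_⟩
    rw [← div_le_iff₀ (by positivity)]
    exact Finset.single_le_sum (f := fun w : ℕ+ => D w / r ^ (w : ℕ))
      (fun w _ => div_nonneg (hD₀ w) (by positivity)) (hfin.mem_toFinset.2 hw)
  refine ⟨fun w => 2 / β * ((w : ℕ) : ℝ) ^ η + A * (1 - r ^ (w : ℕ)), fun w => ?_,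
    fun w hw => ?_⟩
  · have : 0 ≤ 1 - r ^ (w : ℕ) := sub_nonneg.2 (pow_le_one₀ hr₀.le hr₁)
    positivity
  · have h₂ := mul_le_mul_of_nonneg_left
      (one_sub_pow_drift (α := α) (k := k) hβ₀ hβ₁ hq₀ hq₁ hr hw) hA₀
    have h₁ : D w ≤ 2 / β * ((w : ℕ) : ℝ) ^ η + A * r ^ (w : ℕ) := by
      rcases lt_or_ge (w : ℕ) N with h | h
      · have : 0 ≤ 2 / β * ((w : ℕ) : ℝ) ^ η := by positivity
        linarith [hA w h]
      · have h₃ := mul_le_mul_of_nonneg_left (hN w h) (by positivity : 0 ≤ 2 / β)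
        have h₄ : 2 / β * (β / 2 * ((w : ℕ) : ℝ) ^ η) = ((w : ℕ) : ℝ) ^ η := by field_simp
        have h₅ : 0 ≤ A * r ^ (w : ℕ) := by positivity
        rw [mul_add, h₄] at h₃
        linarith
    simp only [hD] at h₁
    linarith

theorem exists_isStationary_moment (hα : 0 < α) (hβ₀ : 0 < β) (hβ₁ : β < 1)
    (hk₁ : k < 1) {p : ℝ≥0} (hp₀ : 0 < p) (hp₁ : p < 1) {η : ℝ} (hη : 1 ≤ η) :
    ∃ π : PMF ℕ+, IsStationary (windowChain α β k p) π ∧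
      ∑' w : ℕ+, π w * ((w : ℕ) : ℝ≥0∞) ^ η < ∞ := by
  set q : ℝ≥0 := 1 - p with hq
  have hq₀ : 0 < q := tsub_pos_of_lt hp₁
  have hq₁ : q < 1 := tsub_lt_self zero_lt_one hp₀
  obtain ⟨V, hV₀, hV⟩ := exists_lyapunov hα hβ₀ hβ₁ hk₁ (NNReal.coe_pos.2 hq₀)
    (NNReal.coe_lt_one.2 hq₁) hη
  refine exists_isStationary_of_drift (a := 1) (V := fun w => ENNReal.ofReal (V w))
    (fun w => ENNReal.one_le_rpow (Nat.one_le_cast.2 w.pos) (by linarith))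
    (fun w hw => ?_) (by simp) ?_
  · have hqw : q ^ (w : ℕ) ≤ 1 := pow_le_one₀ zero_le hq₁.le
    have h₁ : ((q ^ (w : ℕ) : ℝ≥0) : ℝ≥0∞) = ENNReal.ofReal ((q : ℝ) ^ (w : ℕ)) := by
      rw [← NNReal.coe_pow, ENNReal.ofReal_coe_nnreal]
    have h₂ : ((1 - q ^ (w : ℕ) : ℝ≥0) : ℝ≥0∞) = ENNReal.ofReal (1 - (q : ℝ) ^ (w : ℕ)) := by
      rw [← NNReal.coe_pow, ← NNReal.coe_one, ← NNReal.coe_sub hqw, ENNReal.ofReal_coe_nnreal]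
    have h₃ : ((w : ℕ) : ℝ≥0∞) ^ η = ENNReal.ofReal (((w : ℕ) : ℝ) ^ η) := by
      rw [← ENNReal.ofReal_rpow_of_nonneg (by positivity) (by linarith), ENNReal.ofReal_natCast]
    have h₄ : 0 ≤ 1 - (q : ℝ) ^ (w : ℕ) := sub_nonneg.2 (by exact_mod_cast hqw)
    have h₅ := hV₀ (increase α k w)
    have h₆ := hV₀ (decrease β w)
    rw [tsum_windowChain_mul, ← hq, h₁, h₂, h₃, ← ENNReal.ofReal_mul (by positivity),
      ← ENNReal.ofReal_mul h₄, ← ENNReal.ofReal_add (by positivity) (by positivity),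
      ← ENNReal.ofReal_add (by positivity) (by positivity)]
    exact ENNReal.ofReal_le_ofReal (hV w hw)
  · rw [tsum_windowChain_mul]
    exact ENNReal.add_ne_top.2 ⟨ENNReal.mul_ne_top ENNReal.coe_ne_top ENNReal.ofReal_ne_top,
      ENNReal.mul_ne_top ENNReal.coe_ne_top ENNReal.ofReal_ne_top⟩

end

end TCPCompound

/-! ### The main theorem -/

theorem mainTheorem6 (α β k : ℝ) (hα : 0 < α) (hβ₀ : 0 < β) (hβ₁ : β < 1)
    (hk₀ : 0 < k) (hk₁ : k < 1) (p : ℝ≥0) (hp₀ : 0 < p) (hp₁ : p < 1) :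
    (∃! C : Set ℕ+,
      DiscreteChain.IsCommunicatingClass (TCPCompound.windowChain α β k p) C ∧
      (∀ w ∈ C, DiscreteChain.IsAperiodic (TCPCompound.windowChain α β k p) w ∧
        DiscreteChain.IsPositiveRecurrent (TCPCompound.windowChain α β k p) w) ∧
      (∀ w ∉ C, DiscreteChain.IsTransient (TCPCompound.windowChain α β k p) w)) ∧
    (∃! π : PMF ℕ+, DiscreteChain.IsStationary (TCPCompound.windowChain α β k p) π) ∧
    (∀ π : PMF ℕ+, DiscreteChain.IsStationary (TCPCompound.windowChain α β k p) π →
      ∀ η : ℝ, 1 ≤ η → ∑' w : ℕ+, π w * ((w : ℕ) : ℝ≥0∞) ^ η < ∞) := by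
  have hone := TCPCompound.accessible_one α k hβ₀ hβ₁ hp₀
  obtain ⟨π, hπ, -⟩ := TCPCompound.exists_isStationary_moment hα hβ₀ hβ₁ hk₁ hp₀ hp₁ le_rfl
  have hrec : ∀ w, DiscreteChain.Accessible (TCPCompound.windowChain α β k p) 1 w →
      DiscreteChain.IsPositiveRecurrent (TCPCompound.windowChain α β k p) w := fun w hw =>
    hπ.isPositiveRecurrent (DiscreteChain.pos_of_accessible
      ((DiscreteChain.isStationary_iff_push _ π).1 hπ) (hπ.pos_of_forall_accessible hone) hw)
  refine ⟨⟨{w | DiscreteChain.Communicates _ 1 w}, ⟨⟨1, rfl⟩, fun w hw => ⟨?_, hrec w hw.1⟩,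
    fun w hw => ?_⟩, ?_⟩, ⟨π, hπ, fun π' hπ' => hπ'.unique hone hπ⟩, fun π' hπ' η hη => ?_⟩
  · exact DiscreteChain.isAperiodic_of_self_loop hw.2 hw.1
      (TCPCompound.windowChain_one_one_pos α k hβ₀ hp₀)
  · exact DiscreteChain.isTransient_of_accessible (hone w) fun h => hw ⟨h, hone w⟩
  · rintro C ⟨⟨x, rfl⟩, -, htrans⟩
    have hx : DiscreteChain.Communicates (TCPCompound.windowChain α β k p) x 1 := by
      -- Otherwise 1 would lie outside the class and be transient, though it is recurrent.
      by_contra hx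
      have h := htrans 1 hx
      rw [DiscreteChain.IsTransient, (hrec 1 (DiscreteChain.Accessible.refl 1)).1] at h
      exact lt_irrefl _ h
    ext w
    exact ⟨fun h => ⟨hx.2.trans h.1, h.2.trans hx.1⟩, fun h => ⟨hx.1.trans h.1, h.2.trans hx.2⟩⟩
  -- The law constructed for this `η` is `π'` by uniqueness.
  · obtain ⟨π'', hπ'', hmom⟩ :=
      TCPCompound.exists_isStationary_moment hα hβ₀ hβ₁ hk₁ hp₀ hp₁ hη
    rwa [hπ'.unique hone hπ'']
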